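/- Let $q$ be a nonzero complex number that is not a root of unity. Write $[x,y]=xy-yx$ and $[x,y]_q=q\,xy-q^{-1}yx$. Let $\mathfrak W_q$ be the unital associative algebra over $\mathbb C$ with generators $E_1,E_2,F_1,F_2,K_1^{\pm1},K_2^{\pm1},I^{\pm1}$ and the following relations: $I$ is central, $$II^{-1}=I^{-1}I=1,\qquad K_1K_1^{-1}=K_1^{-1}K_1=1,\qquad K_2K_2^{-1}=K_2^{-1}K_2=1,$$ $$[K_1,E_2]=[K_1,F_2]=[K_1,K_2]=[K_2,E_1]=[K_2,F_1]=0,$$ $$[E_1,K_1]_q=[K_1,F_1]_q=[E_2,K_2]_q=[K_2,F_2]_q=0,$$ $$[E_1,E_2]=[E_1,F_2]=[F_1,E_2]=[F_1,F_2]=0,$$ $$[E_1,F_1]=\frac{K_1-IK_1^{-1}}{q-q^{-1}},\qquad [E_2,F_2]=\frac{IK_2-K_2^{-1}}{q-q^{-1}}.$$ Let $V$ be a $\mathfrak W_q$-module that is finite-dimensional over $\mathbb C$. Then the following conditions are equivalent: (i) The $\mathfrak W_q$-module $V$ is completely reducible. (ii) $K_1$ is diagonalizable on $V$. (iii) $K_2$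 is diagonalizable on $V$. (iv) $I$ is diagonalizable on $V$. -/

import Mathlib

namespace WAlg

/-- The generators `E₁, E₂, F₁, F₂, K₁^{±1}, K₂^{±1}, I^{±1}`. -/
inductive Gen : Type
  | E1 | E2 | F1 | F2 | K1 | K1inv | K2 | K2inv | I | Iinv

/-- A generator as an element of the free algebra on the generators. -/
abbrev fr (g : Gen) : FreeAlgebra ℂ Gen := FreeAlgebra.ι ℂ g

/-- The bracket `[x, y] = xy - yx`. -/
def bracket {A : Type*} [Ring A] (x y : A) : A := x * y - y * x

/-- The `q`-bracket `[x, y]_q = q xy - q⁻¹ yx`. -/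
noncomputable def qBracket {A : Type*} [Ring A] [Algebra ℂ A] (q : ℂ) (x y : A) : A :=
  q • (x * y) - q⁻¹ • (y * x)

open Gen in
/-- The defining relations; `Rel q x y` means that `x = y` is imposed. -/
inductive Rel (q : ℂ) : FreeAlgebra ℂ Gen → FreeAlgebra ℂ Gen → Prop
  | I_central (x : FreeAlgebra ℂ Gen) : Rel q (fr I * x) (x * fr I)
  | I_mul_Iinv : Rel q (fr I * fr Iinv) 1
  | Iinv_mul_I : Rel q (fr Iinv * fr I) 1
  | K1_mul_K1inv : Rel q (fr K1 * fr K1inv) 1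
  | K1inv_mul_K1 : Rel q (fr K1inv * fr K1) 1
  | K2_mul_K2inv : Rel q (fr K2 * fr K2inv) 1
  | K2inv_mul_K2 : Rel q (fr K2inv * fr K2) 1
  | K1_E2 : Rel q (bracket (fr K1) (fr E2)) 0
  | K1_F2 : Rel q (bracket (fr K1) (fr F2)) 0
  | K1_K2 : Rel q (bracket (fr K1) (fr K2)) 0
  | K2_E1 : Rel q (bracket (fr K2) (fr E1)) 0
  | K2_F1 : Rel q (bracket (fr K2) (fr F1)) 0
  | E1_K1 : Rel q (qBracket q (fr E1) (fr K1)) 0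
  | K1_F1 : Rel q (qBracket q (fr K1) (fr F1)) 0
  | E2_K2 : Rel q (qBracket q (fr E2) (fr K2)) 0
  | K2_F2 : Rel q (qBracket q (fr K2) (fr F2)) 0
  | E1_E2 : Rel q (bracket (fr E1) (fr E2)) 0
  | E1_F2 : Rel q (bracket (fr E1) (fr F2)) 0
  | F1_E2 : Rel q (bracket (fr F1) (fr E2)) 0
  | F1_F2 : Rel q (bracket (fr F1) (fr F2)) 0
  | E1_F1 : Rel q (bracket (fr E1) (fr F1)) ((q - q⁻¹)⁻¹ • (fr K1 - fr I * fr K1inv))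
  | E2_F2 : Rel q (bracket (fr E2) (fr F2)) ((q - q⁻¹)⁻¹ • (fr I * fr K2 - fr K2inv))

end WAlg

/-- The unital associative `ℂ`-algebra `𝔚_q` given by generators and relations. -/
abbrev WAlg (q : ℂ) : Type := RingQuot (WAlg.Rel q)

namespace WAlg

/-- The image in `𝔚_q` of a generator. -/
noncomputable def gen (q : ℂ) (g : Gen) : WAlg q := RingQuot.mkAlgHom ℂ (Rel q) (fr g)

/-- The `ℂ`-linear operator by which `X ∈ 𝔚_q` acts on the `𝔚_q`-module `V`. -/
noncomputable def act {q : ℂ} (V : Type*) [AddCommGroup V] [Module ℂ V] [Module (WAlg q) V]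
    [IsScalarTower ℂ (WAlg q) V] (X : WAlg q) : Module.End ℂ V :=
  Algebra.lsmul ℂ ℂ V X

/-- `X ∈ 𝔚_q` is diagonalizable on `V`: `V` is the sum of the eigenspaces of `X` over `ℂ`
(the sum is automatically direct). -/
def IsDiagonalizableOn {q : ℂ} (V : Type*) [AddCommGroup V] [Module ℂ V] [Module (WAlg q) V]
    [IsScalarTower ℂ (WAlg q) V] (X : WAlg q) : Prop :=
  ⨆ θ : ℂ, (act V X).eigenspace θ = ⊤

end WAlg

/-! Both halves of `𝔚_q` satisfy the relations `IsQTriple` with `p = q ^ 2`: the first with `K =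
K₁`, the second with `K = I K₂`. Put `X = K² I⁻¹` and `Y = I K⁻¹`, which commute and have product
`K`. The engine is `E_pow_F_pow_apply`: if `E ^ (r + 1)` kills `u`, then `E ^ (r + j) F ^ j u` is a
nonzero multiple of `Y ^ j ∏_{i < j} (X - p ^ (r + i)) E ^ r u`.

Since `F` is nilpotent, the left side vanishes for large `j`, so on `ker E` the operator `X` is
killed by a polynomial with distinct roots `p ^ i`. The same formula shows that `F` generates `V`
from `ker E`. Hence `X` is diagonalizable on every finite-dimensional `V`, and so `K` is
diagonalizable exactly when `I` is; this links (ii), (iii) and (iv).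

As `I` is central, its eigenvectors span a submodule, and a nonzero complement would contain one
more eigenvector; so (i) gives (iv). Conversely, if `K₁`, `K₂`, `I` are all diagonalizable, then
`ker E₁ ⊓ ker E₂` is spanned by common eigenvectors and generates `V` under `F₁` and `F₂`. Each such
eigenvector generates a simple submodule, because powers of `E₁` and `E₂` raise any nonzero vector
of it back to a nonzero multiple of the generator. So `V` is a sum of simple submodules. -/

section QuantumTriple

/-! ### The relations of one half and their commutation formulas. -/

variable {V : Type*} [AddCommGroup V] [Module ℂ V]

/-- The relations between `E, F, K^{±1}` and the central element `I` in either half of `𝔚_q`,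
with `p = q ^ 2` and `c = (q - q⁻¹)⁻¹`. -/
structure IsQTriple (p c : ℂ) (E F : Module.End ℂ V) (K I : (Module.End ℂ V)ˣ) : Prop where
  E_mul_K : E * K = p⁻¹ • (K * E)
  F_mul_K : F * K = p • (K * F)
  comm_IE : Commute (I : Module.End ℂ V) E
  comm_IF : Commute (I : Module.End ℂ V) F
  comm_IK : Commute I K
  E_mul_F : E * F = F * E + c • ((K : Module.End ℂ V) - ((I * K⁻¹ : (Module.End ℂ V)ˣ) : Module.End ℂ V))

theorem mul_unit_inv_of_mul_unit {A : Type*} [Ring A] [Algebra ℂ A] {p : ℂ} (hp : p ≠ 0) {E : A}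
    {K : Aˣ} (h : E * K = p • (K * E)) : E * (K⁻¹ : Aˣ) = p⁻¹ • ((K⁻¹ : Aˣ) * E) := by
  have : (K : A) * (p • (E * (K⁻¹ : Aˣ))) = E := by
    rw [mul_smul_comm, ← mul_assoc, ← smul_mul_assoc, ← h, Units.mul_inv_cancel_right]
  calc E * (K⁻¹ : Aˣ) = p⁻¹ • ((K⁻¹ : Aˣ) * ((K : A) * (p • (E * (K⁻¹ : Aˣ))))) := by
        rw [Units.inv_mul_cancel_left, smul_smul, inv_mul_cancel₀ hp, one_smul]
    _ = _ := by rw [this]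

namespace IsQTriple

variable {p c : ℂ} {E F : Module.End ℂ V} {K I : (Module.End ℂ V)ˣ}

theorem E_mul_Y (h : IsQTriple p c E F K I) (hp : p ≠ 0) :
    E * (I * K⁻¹ : (Module.End ℂ V)ˣ) = p • ((I * K⁻¹ : (Module.End ℂ V)ˣ) * E) := by
  have := mul_unit_inv_of_mul_unit (inv_ne_zero hp) h.E_mul_K
  rw [Units.val_mul, ← mul_assoc, ← h.comm_IE.eq, mul_assoc, this, inv_inv, mul_smul_comm, mul_assoc]

theorem E_mul_X (h : IsQTriple p c E F K I) :
    E * (K * K * I⁻¹ : (Module.End ℂ V)ˣ) = (p⁻¹ * p⁻¹) • ((K * K * I⁻¹ : (Module.End ℂ V)ˣ) * E) := by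
  have h1 : Commute E (I⁻¹ : (Module.End ℂ V)ˣ) := h.comm_IE.symm.units_inv_right
  simp only [Units.val_mul]
  rw [← mul_assoc, ← mul_assoc, h.E_mul_K, smul_mul_assoc, mul_assoc (K : Module.End ℂ V) E, h.E_mul_K,
    mul_smul_comm, smul_smul, smul_mul_assoc, ← mul_assoc, mul_assoc _ E, h1.eq, mul_assoc _ _ E]

theorem F_mul_X (h : IsQTriple p c E F K I) :
    F * (K * K * I⁻¹ : (Module.End ℂ V)ˣ) = (p * p) • ((K * K * I⁻¹ : (Module.End ℂ V)ˣ) * F) := by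
  have h1 : Commute F (I⁻¹ : (Module.End ℂ V)ˣ) := h.comm_IF.symm.units_inv_right
  simp only [Units.val_mul]
  rw [← mul_assoc, ← mul_assoc, h.F_mul_K, smul_mul_assoc, mul_assoc (K : Module.End ℂ V) F, h.F_mul_K,
    mul_smul_comm, smul_smul, smul_mul_assoc, ← mul_assoc, mul_assoc _ F, h1.eq, mul_assoc _ _ F]

theorem comm_YX (h : IsQTriple p c E F K I) : Commute (I * K⁻¹) (K * K * I⁻¹) := by
  have h1 := h.comm_IK
  have h2 : Commute K (K * K * I⁻¹) :=
    ((Commute.refl K).mul_right (Commute.refl K)).mul_right h1.symm.inv_right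
  exact ((h1.mul_right h1).mul_right (Commute.refl I).inv_right).mul_left h2.inv_left

theorem Y_mul_X (h : IsQTriple p c E F K I) : (I * K⁻¹) * (K * K * I⁻¹) = K := by
  have := h.comm_IK.eq
  calc (I * K⁻¹) * (K * K * I⁻¹) = I * K * I⁻¹ := by group
    _ = K := by rw [this]; group

/-- Each factor `E` that `F` passes leaves a term `K - I K⁻¹`. Collecting these scales `K` by powers
of `p⁻¹` and `I K⁻¹` by powers of `p`, and the two geometric sums differ by the factor `p ^ m`. -/
theorem E_pow_mul_F (h : IsQTriple p c E F K I) (hp : p ≠ 0) (m : ℕ) :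
    E ^ (m + 1) * F = F * E ^ (m + 1) + (c * ∑ i ∈ Finset.range (m + 1), p⁻¹ ^ i) •
      (((K : Module.End ℂ V) - p ^ m • ((I * K⁻¹ : (Module.End ℂ V)ˣ) : Module.End ℂ V)) * E ^ m) := by
  have hY := h.E_mul_Y hp
  have hF := h.E_mul_F
  have hK := h.E_mul_K
  generalize ((I * K⁻¹ : (Module.End ℂ V)ˣ) : Module.End ℂ V) = Y at *
  induction m with
  | zero => simpa using hF
  | succ m ih =>
    have e1 : p⁻¹ * ∑ i ∈ Finset.range (m + 1), p⁻¹ ^ i + 1 =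
        ∑ i ∈ Finset.range (m + 1 + 1), p⁻¹ ^ i := by
      rw [Finset.sum_range_succ' _ (m + 1), Finset.mul_sum]
      simp [pow_succ']
    have e2 : p ^ (m + 1) * ∑ i ∈ Finset.range (m + 1), p⁻¹ ^ i + 1 =
        p ^ (m + 1) * ∑ i ∈ Finset.range (m + 1 + 1), p⁻¹ ^ i := by
      rw [Finset.sum_range_succ _ (m + 1), mul_add, inv_pow, mul_inv_cancel₀ (pow_ne_zero _ hp)]
    rw [← e1] at e2 ⊢
    generalize (∑ i ∈ Finset.range (m + 1), p⁻¹ ^ i) = g at *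
    rw [pow_succ' E (m + 1), mul_assoc, ih, mul_add, ← mul_assoc E F, hF, mul_smul_comm,
      ← mul_assoc E, mul_sub, mul_smul_comm, hK, hY, add_mul, mul_assoc F E, add_assoc]
    congr 1
    simp only [sub_mul, smul_mul_assoc, mul_assoc, ← pow_succ']
    match_scalars
    · ring
    · linear_combination (-c) * e2

end IsQTriple

/-! ### Nilpotency, and polynomials with simple roots. -/

theorem pow_injective_of_forall_pow_ne_one {a : ℂ} (ha0 : a ≠ 0)
    (ha : ∀ n : ℕ, 0 < n → a ^ n ≠ 1) : Function.Injective (fun n : ℕ => a ^ n) :=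
  have key : ∀ m k : ℕ, a ^ (m + (k + 1)) ≠ a ^ m := fun m k h =>
    ha (k + 1) k.succ_pos (mul_left_cancel₀ (pow_ne_zero m ha0) (by rw [← pow_add, h, mul_one]))
  fun m n h => by
    rcases lt_trichotomy m n with h1 | h1 | h1
    · obtain ⟨k, rfl⟩ := Nat.exists_eq_add_of_lt h1
      exact (key m k h.symm).elim
    · exact h1
    · obtain ⟨k, rfl⟩ := Nat.exists_eq_add_of_lt h1
      exact (key n k h).elim

/-- An operator that a unit `K` scales under conjugation by `a`, not a root of unity, is nilpotent:
if `x` is an eigenvector of `A` then so is `K x`, with the eigenvalue scaled by `a`. -/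
theorem Module.End.isNilpotent_of_mul_unit [FiniteDimensional ℂ V] {a : ℂ} (ha0 : a ≠ 0)
    (ha : ∀ n : ℕ, 0 < n → a ^ n ≠ 1) {A : Module.End ℂ V} {K : (Module.End ℂ V)ˣ}
    (h : A * K = a • (K * A)) : IsNilpotent A := by
  have hK : ∀ x : V, x ≠ 0 → (K : Module.End ℂ V) x ≠ 0 := fun x hx h0 => hx <| by
    rw [← Module.End.one_apply (R := ℂ) x, ← K.inv_mul, Module.End.mul_apply, h0, map_zero]
  have key : ∀ e : ℂ, e ≠ 0 → ¬ A.HasEigenvalue e := by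
    intro e he hA
    have hall : ∀ n : ℕ, A.HasEigenvalue (a ^ n * e) := by
      intro n
      induction n with
      | zero => simpa using hA
      | succ n ih =>
        obtain ⟨x, hx⟩ := ih.exists_hasEigenvector
        refine Module.End.hasEigenvalue_of_hasEigenvector (x := (K : Module.End ℂ V) x)
          ⟨Module.End.mem_eigenspace_iff.2 ?_, hK x hx.2⟩
        rw [← Module.End.mul_apply, h, LinearMap.smul_apply, Module.End.mul_apply, hx.apply_eq_smul,
          map_smul, smul_smul]
        congr 1; ring
    refine Set.infinite_of_injective_forall_mem (f := fun n : ℕ => a ^ n * e) ?_ hall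
      A.finite_hasEigenvalue
    exact fun m n hmn => pow_injective_of_forall_pow_ne_one ha0 ha (mul_right_cancel₀ he hmn)
  -- Over `ℂ` the generalized eigenspaces span `V`, and only the one for `0` can be nonzero.
  have h0 : A.maxGenEigenspace 0 = ⊤ := by
    rw [eq_top_iff, ← Module.End.iSup_maxGenEigenspace_eq_top A]
    refine iSup_le fun e => ?_
    by_cases he : e = 0
    · rw [he]
    · intro x hx
      obtain ⟨k, hk⟩ := (Module.End.mem_maxGenEigenspace _ _ _).1 hx
      by_contra hne
      have hx0 : x ≠ 0 := fun h => hne (h ▸ Submodule.zero_mem _)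
      refine key e he (Module.End.hasEigenvalue_of_hasGenEigenvalue (k := k) ?_)
      rw [Module.End.hasGenEigenvalue_iff]
      intro hbot
      exact hx0 ((Submodule.mem_bot ℂ).1 (hbot ▸ Module.End.mem_genEigenspace_nat.2 hk))
  rw [Module.End.maxGenEigenspace_eq_genEigenspace_finrank] at h0
  refine ⟨Module.finrank ℂ V, LinearMap.ext fun x => ?_⟩
  have := Module.End.mem_genEigenspace_nat.1 (h0 ▸ Submodule.mem_top : x ∈ A.genEigenspace 0 _)
  simpa using this

theorem Polynomial.commute_aeval {A : Type*} [Ring A] [Algebra ℂ A] {x y : A} (h : Commute x y)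
    (f : Polynomial ℂ) : Commute (Polynomial.aeval x f) y := by
  induction f using Polynomial.induction_on' with
  | add f g hf hg => rw [map_add]; exact hf.add_left hg
  | monomial n a =>
    rw [Polynomial.aeval_monomial]
    exact (show Commute _ y from Algebra.commutes a y).mul_left (h.pow_left n)

open Polynomial in
theorem Polynomial.ker_aeval_prod_le_iSup_eigenspace (A : Module.End ℂ V) {f : ℕ → ℂ}
    (hf : Function.Injective f) (N : ℕ) :
    LinearMap.ker (aeval A (∏ i ∈ Finset.range N, (X - C (f i)))) ≤ ⨆ μ : ℂ, A.eigenspace μ := by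
  induction N with
  | zero => intro x hx; simp_all
  | succ N ih =>
    rw [Finset.prod_range_succ, ← Polynomial.sup_ker_aeval_eq_ker_aeval_mul_of_coprime]
    · refine sup_le ih (le_trans (fun x hx => ?_) (le_iSup _ (f N)))
      rw [Module.End.mem_eigenspace_iff]
      simpa [sub_eq_zero] using hx
    · refine IsCoprime.prod_left fun i hi => ?_
      exact isCoprime_X_sub_C_of_isUnit_sub
        (sub_ne_zero.2 fun h => (Finset.mem_range.1 hi).ne (hf h)).isUnit

/-! ### The raising formula. -/

namespace IsQTriple

variable {p c : ℂ} {E F : Module.End ℂ V} {K I : (Module.End ℂ V)ˣ}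

open Polynomial in
-- Induction on `j`, passing from `(r, u)` to `(r + 1, F u)`. As `E ^ (r + 1) u = 0` and `K - p ^ r
-- Y = Y (X - p ^ r)`, `E_pow_mul_F` gives one linear factor. Its scalar is nonzero because `p` is
-- not a root of unity.
theorem E_pow_F_pow_apply (h : IsQTriple p c E F K I) (hp0 : p ≠ 0) (hp : ∀ n : ℕ, 0 < n → p ^ n ≠ 1)
    (hc : c ≠ 0) (j : ℕ) : ∀ (r : ℕ) (u : V), (E ^ (r + 1)) u = 0 → ∃ d : ℂ, d ≠ 0 ∧
      (E ^ (r + j)) ((F ^ j) u) = d • (((I * K⁻¹) ^ j : (Module.End ℂ V)ˣ) : Module.End ℂ V)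
        (aeval ((K * K * I⁻¹ : (Module.End ℂ V)ˣ) : Module.End ℂ V)
          (∏ i ∈ Finset.range j, (X - C (p ^ (r + i)))) ((E ^ r) u)) := by
  have hYX := h.comm_YX
  have hK : (K : Module.End ℂ V) = (I * K⁻¹ : (Module.End ℂ V)ˣ) * (K * K * I⁻¹ : (Module.End ℂ V)ˣ) := by
    rw [← Units.val_mul, h.Y_mul_X]
  have hEF := h.E_pow_mul_F hp0
  rw [hK] at hEF
  replace hYX := hYX.units_val
  simp only [Units.val_pow_eq_pow_val]
  clear hK
  generalize ((I * K⁻¹ : (Module.End ℂ V)ˣ) : Module.End ℂ V) = Y at *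
  generalize ((K * K * I⁻¹ : (Module.End ℂ V)ˣ) : Module.End ℂ V) = Z at *
  induction j with
  | zero => intro r u _; exact ⟨1, one_ne_zero, by simp⟩
  | succ j ih =>
    intro r u hu
    have hu2 : (E ^ (r + 1 + 1)) u = 0 := by rw [pow_succ', Module.End.mul_apply, hu, map_zero]
    have hFu : (E ^ (r + 1 + 1)) (F u) = 0 := by
      rw [← Module.End.mul_apply, hEF]
      simp [Module.End.mul_apply, hu, hu2]
    obtain ⟨d, hd, e⟩ := ih (r + 1) (F u) hFu
    have hg : (∑ i ∈ Finset.range (r + 1), p⁻¹ ^ i) ≠ 0 := by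
      intro h0
      have := geom_sum_mul p⁻¹ (r + 1)
      rw [h0, zero_mul, eq_comm, sub_eq_zero, inv_pow, inv_eq_one] at this
      exact hp _ r.succ_pos this
    refine ⟨d * (c * ∑ i ∈ Finset.range (r + 1), p⁻¹ ^ i), mul_ne_zero hd (mul_ne_zero hc hg), ?_⟩
    have e1 : (E ^ (r + 1)) (F u) = (c * ∑ i ∈ Finset.range (r + 1), p⁻¹ ^ i) •
        Y (aeval Z (X - C (p ^ r)) ((E ^ r) u)) := by
      rw [← Module.End.mul_apply, hEF]
      simp [Module.End.mul_apply, hu, Module.algebraMap_end_apply, -map_pow]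
    have hcomm : Commute (aeval Z (∏ i ∈ Finset.range j, (X - C (p ^ (r + 1 + i))))) Y :=
      (commute_aeval hYX.symm _)
    rw [show r + (j + 1) = r + 1 + j by ring, pow_succ F, Module.End.mul_apply, e, e1, map_smul,
      map_smul, smul_smul, Finset.prod_range_succ', ← Module.End.mul_apply (aeval Z _) Y, hcomm.eq,
      Module.End.mul_apply, ← Module.End.mul_apply (Y ^ j), ← pow_succ,
      ← Module.End.mul_apply (aeval Z _) (aeval Z _), ← map_mul]
    simp only [add_zero, add_assoc, add_comm 1]

end IsQTriple

theorem Submodule.aeval_apply_mem {A : Module.End ℂ V} {W : Submodule ℂ V} (hW : ∀ x ∈ W, A x ∈ W)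
    (f : Polynomial ℂ) {x : V} (hx : x ∈ W) : Polynomial.aeval A f x ∈ W := by
  have hpow : ∀ n : ℕ, (A ^ n) x ∈ W := fun n => by
    induction n with
    | zero => simpa using hx
    | succ n ih => rw [pow_succ', Module.End.mul_apply]; exact hW _ ih
  induction f using Polynomial.induction_on' with
  | add f g hf hg => rw [map_add]; exact W.add_mem hf hg
  | monomial n a =>
    rw [Polynomial.aeval_monomial, Module.End.mul_apply, Module.algebraMap_end_apply]
    exact W.smul_mem _ (hpow n)

theorem Module.End.pow_apply_mem {A : Module.End ℂ V} {W : Submodule ℂ V} (hW : ∀ x ∈ W, A x ∈ W)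
    (n : ℕ) {x : V} (hx : x ∈ W) : (A ^ n) x ∈ W := by
  simpa using Submodule.aeval_apply_mem hW (Polynomial.X ^ n) hx

theorem Units.end_apply_eq_zero_iff (K : (Module.End ℂ V)ˣ) {x : V} :
    (K : Module.End ℂ V) x = 0 ↔ x = 0 := by
  refine ⟨fun h0 => ?_, fun h => by rw [h, map_zero]⟩
  rw [← Module.End.one_apply (R := ℂ) x, ← K.inv_mul, Module.End.mul_apply, h0, map_zero]

theorem mem_ker_of_mul_eq_smul {A B : Module.End ℂ V} {a : ℂ} (h : A * B = a • (B * A)) :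
    ∀ x ∈ LinearMap.ker A, B x ∈ LinearMap.ker A := by
  intro x hx
  rw [LinearMap.mem_ker] at *
  rw [← Module.End.mul_apply, h, LinearMap.smul_apply, Module.End.mul_apply, hx, map_zero, smul_zero]

/-! ### Generation by highest weight vectors, and diagonalizability of `K² I⁻¹`. -/

namespace IsQTriple

variable {p c : ℂ} {E F : Module.End ℂ V} {K I : (Module.End ℂ V)ˣ}

open Polynomial in
theorem aeval_E_pow_apply_eq_zero (h : IsQTriple p c E F K I) (hp0 : p ≠ 0)
    (hp : ∀ n : ℕ, 0 < n → p ^ n ≠ 1) (hc : c ≠ 0) {N : ℕ} (hN : F ^ N = 0) {r : ℕ} {u : V}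
    (hu : (E ^ (r + 1)) u = 0) :
    aeval ((K * K * I⁻¹ : (Module.End ℂ V)ˣ) : Module.End ℂ V)
      (∏ i ∈ Finset.range N, (X - C (p ^ (r + i)))) ((E ^ r) u) = 0 := by
  obtain ⟨d, hd, e⟩ := h.E_pow_F_pow_apply hp0 hp hc N r u hu
  rw [hN, LinearMap.zero_apply, map_zero, eq_comm, smul_eq_zero, or_iff_right hd,
    Units.end_apply_eq_zero_iff] at e
  exact e

theorem F_nilpotent [FiniteDimensional ℂ V] (h : IsQTriple p c E F K I) (hp0 : p ≠ 0)
    (hp : ∀ n : ℕ, 0 < n → p ^ n ≠ 1) : IsNilpotent F :=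
  Module.End.isNilpotent_of_mul_unit hp0 hp h.F_mul_K

theorem E_nilpotent [FiniteDimensional ℂ V] (h : IsQTriple p c E F K I) (hp0 : p ≠ 0)
    (hp : ∀ n : ℕ, 0 < n → p ^ n ≠ 1) : IsNilpotent E :=
  Module.End.isNilpotent_of_mul_unit (inv_ne_zero hp0)
    (fun n hn => by rw [inv_pow, ne_eq, inv_eq_one]; exact hp n hn) h.E_mul_K

open Polynomial in
/-- The kernel of an operator `G` commuting with the triple is generated under `F` by the highest
weight vectors in it. -/
theorem ker_le_of_ker_inf_ker_le [FiniteDimensional ℂ V] (h : IsQTriple p c E F K I) (hp0 : p ≠ 0)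
    (hp : ∀ n : ℕ, 0 < n → p ^ n ≠ 1) (hc : c ≠ 0) {G : Module.End ℂ V} (hGE : Commute G E)
    (hGF : Commute G F) (hGK : Commute G K) (hGI : Commute G I) {W : Submodule ℂ V}
    (hW : ∀ x ∈ W, F x ∈ W) (hker : LinearMap.ker G ⊓ LinearMap.ker E ≤ W) :
    LinearMap.ker G ≤ W := by
  obtain ⟨N, hN⟩ := h.F_nilpotent hp0 hp
  obtain ⟨M, hM⟩ := h.E_nilpotent hp0 hp
  have hinv : ∀ {B : Module.End ℂ V}, Commute G B → ∀ x ∈ LinearMap.ker G, B x ∈ LinearMap.ker G :=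
    fun {B} hB => mem_ker_of_mul_eq_smul (a := 1) (by rw [hB.eq, one_smul])
  have hGX : Commute G ((K * K * I⁻¹ : (Module.End ℂ V)ˣ) : Module.End ℂ V) := by
    rw [Units.val_mul, Units.val_mul]
    exact (hGK.mul_right hGK).mul_right hGI.units_inv_right
  have hGY : Commute G ((I * K⁻¹ : (Module.End ℂ V)ˣ)⁻¹ : (Module.End ℂ V)ˣ) := by
    refine Commute.units_inv_right ?_
    rw [Units.val_mul]
    exact hGI.mul_right hGK.units_inv_right
  have hEX := mem_ker_of_mul_eq_smul h.E_mul_X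
  have hEY := mem_ker_of_mul_eq_smul (mul_unit_inv_of_mul_unit hp0 (h.E_mul_Y hp0))
  -- Induction on the power of `E` that kills `u`: subtracting a suitable `F ^ r z` with `z ∈ ker G
  -- ⊓ ker E` lowers it.
  suffices H : ∀ r : ℕ, ∀ u ∈ LinearMap.ker G, (E ^ r) u = 0 → u ∈ W from
    fun u hu => H M u hu (by rw [hM, LinearMap.zero_apply])
  intro r
  induction r with
  | zero => intro u _ hu; rw [show u = 0 from hu]; exact W.zero_mem
  | succ r ih =>
    intro u huG hu
    have hP := h.aeval_E_pow_apply_eq_zero hp0 hp hc hN hu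
    -- The exponents are at least `r` in the first product and below `r` in the second. The first
    -- product kills `w = E ^ r u`, so the Bézout coefficient `B` inverts the second one on `w`.
    have hcop : IsCoprime (∏ i ∈ Finset.range N, (X - C (p ^ (r + i))))
        (∏ i ∈ Finset.range r, (X - C (p ^ (0 + i)))) := by
      refine IsCoprime.prod_left fun i _ => IsCoprime.prod_right fun j hj => ?_
      refine isCoprime_X_sub_C_of_isUnit_sub (sub_ne_zero.2 fun e => ?_).isUnit
      have := pow_injective_of_forall_pow_ne_one hp0 hp e
      have := Finset.mem_range.1 hj
      omega
    obtain ⟨A, B, hAB⟩ := hcop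
    set w := (E ^ r) u with hw
    have hwE : w ∈ LinearMap.ker E := by
      rw [LinearMap.mem_ker, hw, ← Module.End.mul_apply, ← pow_succ', hu]
    have hwG : w ∈ LinearMap.ker G := Module.End.pow_apply_mem (hinv hGE) r huG
    -- Chosen to make `E ^ r F ^ r z` a nonzero multiple of `w`: in the raising formula `Y ^ (-r)`
    -- cancels `Y ^ r`, and `B` cancels the product.
    set z := (((I * K⁻¹)⁻¹ ^ r : (Module.End ℂ V)ˣ) : Module.End ℂ V)
      (aeval ((K * K * I⁻¹ : (Module.End ℂ V)ˣ) : Module.End ℂ V) B w) with hz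
    have hzE : z ∈ LinearMap.ker E := by
      rw [hz, Units.val_pow_eq_pow_val]
      exact Module.End.pow_apply_mem hEY r (Submodule.aeval_apply_mem hEX B hwE)
    have hzG : z ∈ LinearMap.ker G := by
      rw [hz, Units.val_pow_eq_pow_val]
      exact Module.End.pow_apply_mem (hinv hGY) r (Submodule.aeval_apply_mem (hinv hGX) B hwG)
    obtain ⟨d, hd, e⟩ := h.E_pow_F_pow_apply hp0 hp hc r 0 z (by simpa using hzE)
    have hYQ : ∀ f : ℂ[X], Commute
        (aeval ((K * K * I⁻¹ : (Module.End ℂ V)ˣ) : Module.End ℂ V) f)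
        (((I * K⁻¹)⁻¹ ^ r : (Module.End ℂ V)ˣ) : Module.End ℂ V) := fun f =>
      Polynomial.commute_aeval (h.comm_YX.inv_left.pow_left r).symm.units_val f
    have e2 : (E ^ r) ((F ^ r) z) = d • w := by
      rw [zero_add, pow_zero, Module.End.one_apply] at e
      rw [e, hz, ← Module.End.mul_apply (aeval _ _) (Units.val _), (hYQ _).eq, Module.End.mul_apply,
        ← Module.End.mul_apply (Units.val _) (Units.val _), ← Units.val_mul, inv_pow, mul_inv_cancel,
        Units.val_one, Module.End.one_apply, ← Module.End.mul_apply (aeval _ _) (aeval _ _), ← map_mul,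
        mul_comm _ B]
      congr 1
      have := congrArg (fun f => aeval ((K * K * I⁻¹ : (Module.End ℂ V)ˣ) : Module.End ℂ V) f w) hAB
      simpa only [map_add, map_mul, LinearMap.add_apply, Module.End.mul_apply, hP, map_zero, zero_add,
        map_one, Module.End.one_apply] using this
    have h3 : u - d⁻¹ • (F ^ r) z ∈ W := by
      refine ih _ (Submodule.sub_mem _ huG (Submodule.smul_mem _ _
        (Module.End.pow_apply_mem (hinv hGF) r hzG))) ?_
      rw [map_sub, map_smul, e2, smul_smul, inv_mul_cancel₀ hd, one_smul, sub_self]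
    rw [← sub_add_cancel u (d⁻¹ • (F ^ r) z)]
    exact W.add_mem h3 (W.smul_mem _ (Module.End.pow_apply_mem hW r (hker ⟨hzG, hzE⟩)))

theorem eq_top_of_ker_le [FiniteDimensional ℂ V] (h : IsQTriple p c E F K I) (hp0 : p ≠ 0)
    (hp : ∀ n : ℕ, 0 < n → p ^ n ≠ 1) (hc : c ≠ 0) {W : Submodule ℂ V}
    (hW : ∀ x ∈ W, F x ∈ W) (hker : LinearMap.ker E ≤ W) : W = ⊤ := by
  have := h.ker_le_of_ker_inf_ker_le hp0 hp hc (G := 0) (Commute.zero_left _) (Commute.zero_left _)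
    (Commute.zero_left _) (Commute.zero_left _) hW (inf_le_right.trans hker)
  rwa [LinearMap.ker_zero, top_le_iff] at this

/-- The eigenspaces cover `ker E`, where a polynomial with simple roots kills `X`. Their sum is
stable under `F`, which scales eigenvalues by `(p * p)⁻¹`, so it is everything. -/
theorem iSup_eigenspace_X [FiniteDimensional ℂ V] (h : IsQTriple p c E F K I) (hp0 : p ≠ 0)
    (hp : ∀ n : ℕ, 0 < n → p ^ n ≠ 1) (hc : c ≠ 0) :
    ⨆ μ : ℂ, Module.End.eigenspace ((K * K * I⁻¹ : (Module.End ℂ V)ˣ) : Module.End ℂ V) μ = ⊤ := by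
  obtain ⟨N, hN⟩ := h.F_nilpotent hp0 hp
  refine h.eq_top_of_ker_le hp0 hp hc ?_ ?_
  · intro x hx
    refine Submodule.iSup_induction _ (motive := fun x => F x ∈ _) hx ?_ ?_ ?_
    · intro μ x hx
      refine Submodule.mem_iSup_of_mem ((p * p)⁻¹ * μ) ?_
      rw [Module.End.mem_eigenspace_iff] at *
      have h1 := congrArg (fun T : Module.End ℂ V => T x) h.F_mul_X
      simp only [Module.End.mul_apply, LinearMap.smul_apply] at h1
      rw [hx, map_smul] at h1
      rw [mul_smul, h1, smul_smul, inv_mul_cancel₀ (mul_ne_zero hp0 hp0), one_smul]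
    · rw [map_zero]; exact Submodule.zero_mem _
    · intro x y hx hy; rw [map_add]; exact Submodule.add_mem _ hx hy
  · intro x hx
    refine Polynomial.ker_aeval_prod_le_iSup_eigenspace _
      (f := fun i => p ^ (0 + i)) ?_ N ?_
    · simpa using pow_injective_of_forall_pow_ne_one hp0 hp
    · exact h.aeval_E_pow_apply_eq_zero hp0 hp hc hN (r := 0) (by simpa using hx)

end IsQTriple

/-! ### Simultaneous diagonalization. -/

namespace Module.End

theorem apply_mem_eigenspace_of_commute {A B : Module.End ℂ V} (h : Commute A B) (μ : ℂ) :
    ∀ x ∈ A.eigenspace μ, B x ∈ A.eigenspace μ := by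
  intro x hx
  rw [mem_eigenspace_iff] at *
  rw [← mul_apply, h.eq, mul_apply, hx, map_smul]

theorem le_of_forall_inf_eigenspace_le [FiniteDimensional ℂ V] {A : Module.End ℂ V}
    (hA : ⨆ μ : ℂ, A.eigenspace μ = ⊤) {H W : Submodule ℂ V} (hH : ∀ x ∈ H, A x ∈ H)
    (hW : ∀ μ, H ⊓ A.eigenspace μ ≤ W) : H ≤ W := by
  rw [Submodule.eq_iSup_inf_genEigenspace (f := A) 1 hH hA]
  exact iSup_le hW

theorem iSup_eigenspace_eq_top_of_commute [FiniteDimensional ℂ V] {A B C : Module.End ℂ V}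
    (hAB : Commute A B) (hA : ⨆ μ : ℂ, A.eigenspace μ = ⊤) (hB : ⨆ μ : ℂ, B.eigenspace μ = ⊤)
    (hC : ∀ a b, A.eigenspace a ⊓ B.eigenspace b ≤ ⨆ μ : ℂ, C.eigenspace μ) :
    ⨆ μ : ℂ, C.eigenspace μ = ⊤ := by
  rw [eq_top_iff, ← hA]
  exact iSup_le fun a => le_of_forall_inf_eigenspace_le hB (apply_mem_eigenspace_of_commute hAB a)
    fun b => hC a b

theorem eigenspace_units_le_inv (A : (Module.End ℂ V)ˣ) (μ : ℂ) :
    (A : Module.End ℂ V).eigenspace μ ≤ (↑A⁻¹ : Module.End ℂ V).eigenspace μ⁻¹ := by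
  intro x hx
  rw [mem_eigenspace_iff] at *
  have h1 : x = μ • (↑A⁻¹ : Module.End ℂ V) x := by
    rw [← map_smul, ← hx, ← mul_apply, A.inv_mul, one_apply]
  by_cases hμ : μ = 0
  · rw [hμ, zero_smul] at h1
    rw [h1, map_zero, smul_zero]
  · conv_rhs => rw [h1, smul_smul, inv_mul_cancel₀ hμ, one_smul]

theorem iSup_eigenspace_units_inv (A : (Module.End ℂ V)ˣ)
    (h : ⨆ μ : ℂ, (A : Module.End ℂ V).eigenspace μ = ⊤) :
    ⨆ μ : ℂ, (↑A⁻¹ : Module.End ℂ V).eigenspace μ = ⊤ := by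
  rw [eq_top_iff, ← h]
  exact iSup_le fun μ => le_iSup_of_le μ⁻¹ (eigenspace_units_le_inv A μ)

/-- With `X = K² J⁻¹`, the operator `J` is scalar on a nonzero joint eigenspace of `K` and `X`. On
one of `J` and `X`, the square `K²` is a scalar `z²`, nonzero since `K` is invertible, so `K` splits
the space into eigenspaces for `z` and `-z`. -/
theorem iSup_eigenspace_iff_of_sq_mul_inv [FiniteDimensional ℂ V] {K J : (Module.End ℂ V)ˣ}
    (hc : Commute K J)
    (hX : ⨆ μ : ℂ, Module.End.eigenspace ((K * K * J⁻¹ : (Module.End ℂ V)ˣ) : Module.End ℂ V) μ = ⊤) :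
    (⨆ μ : ℂ, (K : Module.End ℂ V).eigenspace μ = ⊤) ↔
      ⨆ μ : ℂ, (J : Module.End ℂ V).eigenspace μ = ⊤ := by
  have hKX : Commute K (K * K * J⁻¹) :=
    ((Commute.refl K).mul_right (Commute.refl K)).mul_right hc.inv_right
  have hJX : Commute J (K * K * J⁻¹) :=
    (hc.symm.mul_right hc.symm).mul_right (Commute.refl J).inv_right
  have hJXK : J * (K * K * J⁻¹) = K * K := by rw [hJX.eq]; group
  have key : ∀ x : V, (J : Module.End ℂ V) (((K * K * J⁻¹ : (Module.End ℂ V)ˣ) : Module.End ℂ V) x) =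
      (K : Module.End ℂ V) ((K : Module.End ℂ V) x) := fun x => by
    rw [← mul_apply, ← Units.val_mul, hJXK, Units.val_mul, mul_apply]
  constructor
  · intro hK
    refine iSup_eigenspace_eq_top_of_commute hKX.units_val hK hX fun k ξ => ?_
    rintro x ⟨h1, h2⟩
    have h1 := mem_eigenspace_iff.1 h1
    have h2 := mem_eigenspace_iff.1 h2
    have h3 := key x
    rw [h1, h2, map_smul, map_smul, h1, smul_smul] at h3
    by_cases hξ : ξ = 0
    · rw [hξ, zero_smul, Units.end_apply_eq_zero_iff] at h2
      rw [h2]; exact Submodule.zero_mem _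
    · refine Submodule.mem_iSup_of_mem (ξ⁻¹ * (k * k)) (mem_eigenspace_iff.2 ?_)
      rw [mul_smul, ← h3, smul_smul, inv_mul_cancel₀ hξ, one_smul]
  · intro hJ
    refine iSup_eigenspace_eq_top_of_commute hJX.units_val hJ hX fun ι ξ => ?_
    rintro x ⟨h1, h2⟩
    have h1 := mem_eigenspace_iff.1 h1
    have h2 := mem_eigenspace_iff.1 h2
    have h3 := key x
    rw [h2, map_smul, h1, smul_smul] at h3
    obtain ⟨z, hz⟩ := IsAlgClosed.exists_pow_nat_eq (ξ * ι) zero_lt_two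
    rw [← hz] at h3
    by_cases hz0 : z = 0
    · rw [hz0, zero_pow two_ne_zero, zero_smul, eq_comm, Units.end_apply_eq_zero_iff,
        Units.end_apply_eq_zero_iff] at h3
      rw [h3]; exact Submodule.zero_mem _
    · have e : x = (2 * z)⁻¹ • (((K : Module.End ℂ V) x + z • x) - ((K : Module.End ℂ V) x - z • x)) := by
        rw [add_sub_sub_cancel, ← add_smul, smul_smul, ← two_mul,
          inv_mul_cancel₀ (mul_ne_zero two_ne_zero hz0), one_smul]
      rw [e]
      refine Submodule.smul_mem _ _ (Submodule.sub_mem _ (Submodule.mem_iSup_of_mem z ?_)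
        (Submodule.mem_iSup_of_mem (-z) ?_))
      · rw [mem_eigenspace_iff, map_add, map_smul, ← h3]; module
      · rw [mem_eigenspace_iff, map_sub, map_smul, ← h3]; module

theorem apply_pow_apply_of_mul_eq_smul {A B : Module.End ℂ V} {a : ℂ} (ha : a ≠ 0)
    (h : A * B = a • (B * A)) {μ : ℂ} {x : V} (hx : B x = μ • x) (n : ℕ) :
    B ((A ^ n) x) = (a⁻¹ ^ n * μ) • (A ^ n) x := by
  induction n with
  | zero => simpa using hx
  | succ n ih =>
    have h1 := congrArg (fun T : Module.End ℂ V => T ((A ^ n) x)) h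
    simp only [mul_apply, LinearMap.smul_apply] at h1
    rw [ih, map_smul] at h1
    rw [pow_succ', mul_apply, pow_succ', mul_assoc, mul_smul, h1, smul_smul, inv_mul_cancel₀ ha, one_smul]

end Module.End

/-! ### Subspaces generated under powers of one operator. -/

/-- The span of all `F ^ a t` with `t ∈ T`. -/
def Submodule.powSpan (F : Module.End ℂ V) (T : Submodule ℂ V) : Submodule ℂ V :=
  ⨆ a : ℕ, T.map (F ^ a)

namespace Submodule

variable {F G : Module.End ℂ V} {T : Submodule ℂ V}

theorem pow_apply_mem_powSpan (a : ℕ) {t : V} (ht : t ∈ T) : (F ^ a) t ∈ powSpan F T :=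
  mem_iSup_of_mem a (mem_map_of_mem ht)

theorem le_powSpan : T ≤ powSpan F T := fun t ht => by
  simpa using pow_apply_mem_powSpan (F := F) 0 ht

theorem powSpan_le {W : Submodule ℂ V} (h : ∀ a : ℕ, ∀ t ∈ T, (F ^ a) t ∈ W) : powSpan F T ≤ W :=
  iSup_le fun a => map_le_iff_le_comap.2 fun t ht => h a t ht

theorem apply_mem_powSpan_of_forall {W : Submodule ℂ V} (h : ∀ a : ℕ, ∀ t ∈ T, G ((F ^ a) t) ∈ W) :
    ∀ x ∈ powSpan F T, G x ∈ W := fun _ hx =>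
  powSpan_le (W := W.comap G) (fun a t ht => h a t ht) hx

theorem self_apply_mem_powSpan : ∀ x ∈ powSpan F T, F x ∈ powSpan F T :=
  apply_mem_powSpan_of_forall fun a t ht => by
    rw [← Module.End.mul_apply, ← pow_succ']
    exact pow_apply_mem_powSpan _ ht

theorem apply_mem_powSpan {g : ℂ} (hg : g ≠ 0) (h : F * G = g • (G * F)) (hT : ∀ t ∈ T, G t ∈ T) :
    ∀ x ∈ powSpan F T, G x ∈ powSpan F T := by
  have key : ∀ a : ℕ, ∀ t ∈ T, G ((F ^ a) t) = g⁻¹ ^ a • (F ^ a) (G t) := by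
    intro a t ht
    induction a with
    | zero => simp
    | succ a ih =>
      have h1 := congrArg (fun T : Module.End ℂ V => T ((F ^ a) t)) h
      simp only [Module.End.mul_apply, LinearMap.smul_apply] at h1
      rw [ih, map_smul] at h1
      rw [pow_succ', Module.End.mul_apply, pow_succ', mul_smul, Module.End.mul_apply, h1, smul_smul,
        inv_mul_cancel₀ hg, one_smul]
  refine apply_mem_powSpan_of_forall fun a t ht => ?_
  rw [key a t ht]
  exact smul_mem _ _ (pow_apply_mem_powSpan a (hT t ht))

theorem apply_mem_powSpan_of_commute (h : Commute F G) (hT : ∀ t ∈ T, G t ∈ T) :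
    ∀ x ∈ powSpan F T, G x ∈ powSpan F T :=
  apply_mem_powSpan one_ne_zero (by rw [h.eq, one_smul]) hT

theorem exists_sum_of_mem_powSpan {N : ℕ} (hN : F ^ N = 0) {x : V} (hx : x ∈ powSpan F T) :
    ∃ t : ℕ → V, (∀ a, t a ∈ T) ∧ x = ∑ a ∈ Finset.range N, (F ^ a) (t a) := by
  refine iSup_induction _ (motive := fun x => ∃ t : ℕ → V, (∀ a, t a ∈ T) ∧
    x = ∑ a ∈ Finset.range N, (F ^ a) (t a)) hx ?_ ⟨0, fun _ => T.zero_mem, by simp⟩ ?_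
  · rintro a _ ⟨t, ht, rfl⟩
    refine ⟨Pi.single a t, fun b => ?_, ?_⟩
    · by_cases hb : b = a
      · subst hb; simpa using ht
      · simp [hb]
    · by_cases ha : a < N
      · rw [Finset.sum_eq_single a]
        · simp
        · intro b _ hb; simp [hb]
        · intro h; exact (h (Finset.mem_range.2 ha)).elim
      · rw [Finset.sum_eq_zero]
        · rw [pow_eq_zero_of_le (not_lt.1 ha) hN, LinearMap.zero_apply]
        · intro b hb
          have : b ≠ a := fun h => ha (h ▸ Finset.mem_range.1 hb)
          simp [this]
  · rintro x y ⟨s, hs, rfl⟩ ⟨t, ht, rfl⟩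
    exact ⟨s + t, fun a => T.add_mem (hs a) (ht a), by simp [Finset.sum_add_distrib]⟩

end Submodule

/-! ### Raising a vector back to highest weight. -/

namespace IsQTriple

variable {p c : ℂ} {E F : Module.End ℂ V} {K I : (Module.End ℂ V)ˣ}

open Polynomial in
-- Vanishing would force `ξ = p ^ i` with `i < m`. For some `r < m`, the vector `E ^ r F ^ m t` is
-- nonzero and killed by `E`; its `X`-eigenvalue `p ^ (2r - 2m) ξ` must then be some `p ^ (r + j)`
-- with `j ≥ 0`. So `r + i = 2m + j`, which is impossible for `r, i < m`.
theorem E_pow_F_pow_apply_ne_zero [FiniteDimensional ℂ V] (h : IsQTriple p c E F K I) (hp0 : p ≠ 0)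
    (hp : ∀ n : ℕ, 0 < n → p ^ n ≠ 1) (hc : c ≠ 0) {t : V} (ht : E t = 0) {ξ : ℂ}
    (hξ : ((K * K * I⁻¹ : (Module.End ℂ V)ˣ) : Module.End ℂ V) t = ξ • t) {m : ℕ}
    (hm : (F ^ m) t ≠ 0) : (E ^ m) ((F ^ m) t) ≠ 0 := by
  have aeval_zero : ∀ (N r : ℕ) (w : V) (μ : ℂ), w ≠ 0 →
      ((K * K * I⁻¹ : (Module.End ℂ V)ˣ) : Module.End ℂ V) w = μ • w →
      aeval ((K * K * I⁻¹ : (Module.End ℂ V)ˣ) : Module.End ℂ V)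
        (∏ i ∈ Finset.range N, (X - C (p ^ (r + i)))) w = 0 → ∃ i < N, μ = p ^ (r + i) := by
    intro N r w μ hw hμ h0
    rw [Module.End.aeval_apply_of_hasEigenvector ⟨Module.End.mem_eigenspace_iff.2 hμ, hw⟩,
      smul_eq_zero, or_iff_left hw, eval_prod, Finset.prod_eq_zero_iff] at h0
    obtain ⟨i, hi, h0⟩ := h0
    exact ⟨i, Finset.mem_range.1 hi, by simpa [sub_eq_zero] using h0⟩
  intro h0
  have ht0 : t ≠ 0 := fun e => hm (by rw [e, map_zero])
  obtain ⟨d, hd, e⟩ := h.E_pow_F_pow_apply hp0 hp hc m 0 t (by simpa using ht)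
  rw [zero_add, h0, eq_comm, smul_eq_zero, or_iff_right hd, Units.end_apply_eq_zero_iff, pow_zero,
    Module.End.one_apply] at e
  obtain ⟨i, hi, e1⟩ := aeval_zero _ _ _ _ ht0 hξ e
  obtain ⟨N, hN⟩ := h.F_nilpotent hp0 hp
  obtain ⟨r, hr, hr1, hr2⟩ : ∃ r < m, (E ^ r) ((F ^ m) t) ≠ 0 ∧ (E ^ (r + 1)) ((F ^ m) t) = 0 := by
    by_contra! hcon
    have : ∀ r ≤ m, (E ^ r) ((F ^ m) t) ≠ 0 := fun r => by
      induction r with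
      | zero => intro _; simpa using hm
      | succ r ih => intro hr; exact hcon r hr (ih (by omega))
    exact this m le_rfl h0
  have e2 := h.aeval_E_pow_apply_eq_zero hp0 hp hc hN hr2
  have hXF := Module.End.apply_pow_apply_of_mul_eq_smul (mul_ne_zero hp0 hp0) h.F_mul_X hξ m
  have hXE := Module.End.apply_pow_apply_of_mul_eq_smul
    (mul_ne_zero (inv_ne_zero hp0) (inv_ne_zero hp0)) h.E_mul_X hXF r
  obtain ⟨j, hj, e3⟩ := aeval_zero _ _ _ _ hr1 hXE e2
  rw [e1] at e3
  have e4 : p ^ (r + r + (0 + i)) = p ^ (r + j + (m + m)) := by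
    have e5 := mul_inv_cancel₀ (pow_ne_zero m (mul_ne_zero hp0 hp0))
    rw [← mul_inv, inv_inv, inv_pow] at e3
    generalize ((p * p) ^ m)⁻¹ = y at e3 e5
    linear_combination (p * p) ^ m * e3 - p ^ (r + r + (0 + i)) * e5
  have := pow_injective_of_forall_pow_ne_one hp0 hp e4
  omega

/-- Write `x` as a sum of `F ^ a t_a` and let `N` be the largest index with a nonzero term. Then `E
^ N` kills the lower terms and sends the top one to a nonzero vector of `T`, since `X` and `Y` are
scalar on `T`. -/
theorem exists_E_pow_apply_mem [FiniteDimensional ℂ V] (h : IsQTriple p c E F K I) (hp0 : p ≠ 0)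
    (hp : ∀ n : ℕ, 0 < n → p ^ n ≠ 1) (hc : c ≠ 0) {T : Submodule ℂ V} (hTE : ∀ t ∈ T, E t = 0)
    {κ ι : ℂ} (hTK : ∀ t ∈ T, (K : Module.End ℂ V) t = κ • t)
    (hTI : ∀ t ∈ T, (I : Module.End ℂ V) t = ι • t) {x : V} (hx : x ∈ T.powSpan F) (hx0 : x ≠ 0) :
    ∃ m : ℕ, (E ^ m) x ∈ T ∧ (E ^ m) x ≠ 0 := by
  have inv : ∀ {A : (Module.End ℂ V)ˣ} {μ : ℂ}, (∀ t ∈ T, (A : Module.End ℂ V) t = μ • t) →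
      ∀ t ∈ T, (↑A⁻¹ : Module.End ℂ V) t = μ⁻¹ • t := fun {A μ} hA t ht =>
    Module.End.mem_eigenspace_iff.1
      (Module.End.eigenspace_units_le_inv A μ (Module.End.mem_eigenspace_iff.2 (hA t ht)))
  have hX : ∀ t ∈ T, ((K * K * I⁻¹ : (Module.End ℂ V)ˣ) : Module.End ℂ V) t = (ι⁻¹ * (κ * κ)) • t := by
    intro t ht
    rw [Units.val_mul, Units.val_mul, Module.End.mul_apply, Module.End.mul_apply, inv hTI t ht, map_smul,
      map_smul, hTK t ht, map_smul, hTK t ht, smul_smul, smul_smul, mul_assoc]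
  have hY : ∀ t ∈ T, ((I * K⁻¹ : (Module.End ℂ V)ˣ) : Module.End ℂ V) t = (κ⁻¹ * ι) • t := by
    intro t ht
    rw [Units.val_mul, Module.End.mul_apply, inv hTK t ht, map_smul, hTI t ht, smul_smul]
  have hmem : ∀ m : ℕ, ∀ t ∈ T, (E ^ m) ((F ^ m) t) ∈ T := by
    intro m t ht
    obtain ⟨d, hd, e⟩ := h.E_pow_F_pow_apply hp0 hp hc m 0 t (by simpa using hTE t ht)
    rw [zero_add, pow_zero, Module.End.one_apply, Units.val_pow_eq_pow_val] at e
    rw [e]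
    refine T.smul_mem _ (Module.End.pow_apply_mem (fun y hy => ?_) m
      (Submodule.aeval_apply_mem (fun y hy => ?_) _ ht))
    · rw [hY y hy]; exact T.smul_mem _ hy
    · rw [hX y hy]; exact T.smul_mem _ hy
  have hzero : ∀ m a : ℕ, a < m → ∀ t ∈ T, (E ^ m) ((F ^ a) t) = 0 := by
    intro m a ha t ht
    obtain ⟨k, rfl⟩ := Nat.exists_eq_add_of_lt ha
    rw [show a + k + 1 = k + 1 + a by ring, pow_add, Module.End.mul_apply, pow_succ,
      Module.End.mul_apply, hTE _ (hmem a t ht), map_zero]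
  obtain ⟨N, hN⟩ := h.F_nilpotent hp0 hp
  obtain ⟨t, ht, rfl⟩ := Submodule.exists_sum_of_mem_powSpan hN hx
  clear hx hN
  induction N with
  | zero => simp at hx0
  | succ N ih =>
    by_cases hF : (F ^ N) (t N) = 0
    · rw [Finset.sum_range_succ, hF, add_zero] at hx0 ⊢
      exact ih hx0
    · have e : (E ^ N) (∑ a ∈ Finset.range (N + 1), (F ^ a) (t a)) = (E ^ N) ((F ^ N) (t N)) := by
        rw [Finset.sum_range_succ, map_add, map_sum, Finset.sum_eq_zero, zero_add]
        exact fun a ha => hzero N a (Finset.mem_range.1 ha) _ (ht a)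
      refine ⟨N, ?_, ?_⟩ <;> rw [e]
      · exact hmem N _ (ht N)
      · exact h.E_pow_F_pow_apply_ne_zero hp0 hp hc (hTE _ (ht N)) (hX _ (ht N)) hF

theorem E_apply_mem_powSpan (h : IsQTriple p c E F K I) {T : Submodule ℂ V}
    (hTE : ∀ t ∈ T, E t = 0)
    (hK : ∀ x ∈ T.powSpan F, (K : Module.End ℂ V) x ∈ T.powSpan F)
    (hY : ∀ x ∈ T.powSpan F, ((I * K⁻¹ : (Module.End ℂ V)ˣ) : Module.End ℂ V) x ∈ T.powSpan F) :
    ∀ x ∈ T.powSpan F, E x ∈ T.powSpan F := by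
  refine Submodule.apply_mem_powSpan_of_forall fun a t ht => ?_
  induction a with
  | zero => rw [pow_zero, Module.End.one_apply, hTE t ht]; exact Submodule.zero_mem _
  | succ a ih =>
    have hx := Submodule.pow_apply_mem_powSpan (F := F) a ht
    rw [pow_succ', Module.End.mul_apply, ← Module.End.mul_apply, h.E_mul_F, LinearMap.add_apply,
      LinearMap.smul_apply, LinearMap.sub_apply, Module.End.mul_apply]
    exact Submodule.add_mem _ (Submodule.self_apply_mem_powSpan _ ih)
      (Submodule.smul_mem _ _ (Submodule.sub_mem _ (hK _ hx) (hY _ hx)))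

end IsQTriple

end QuantumTriple

/-! ### The two halves of `𝔚_q` acting on `V`. -/

namespace WAlg

variable {q : ℂ}

open Gen

theorem gen_mul_gen_of_bracket {x y : Gen} (h : Rel q (bracket (fr x) (fr y)) 0) :
    Commute (gen q x) (gen q y) := by
  have := RingQuot.mkAlgHom_rel ℂ h
  rw [bracket, map_sub, map_mul, map_mul, map_zero, sub_eq_zero] at this
  exact this

theorem gen_mul_gen_of_qBracket (hq0 : q ≠ 0) {x y : Gen} (h : Rel q (qBracket q (fr x) (fr y)) 0) :
    gen q x * gen q y = (q ^ 2)⁻¹ • (gen q y * gen q x) := by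
  have := RingQuot.mkAlgHom_rel ℂ h
  rw [qBracket, map_sub, map_smul, map_smul, map_mul, map_mul, map_zero, sub_eq_zero] at this
  change q • (gen q x * gen q y) = q⁻¹ • (gen q y * gen q x) at this
  rw [← inv_smul_smul₀ hq0 (gen q x * gen q y), this, smul_smul]
  congr 1
  ring

theorem gen_mul_gen_eq_one {x y : Gen} (h : Rel q (fr x * fr y) 1) : gen q x * gen q y = 1 := by
  have := RingQuot.mkAlgHom_rel ℂ h
  rwa [map_mul, map_one] at this

theorem commute_gen_I (x : Gen) : Commute (gen q Gen.I) (gen q x) := by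
  have := RingQuot.mkAlgHom_rel ℂ (Rel.I_central (q := q) (fr x))
  rwa [map_mul, map_mul] at this

theorem gen_E1_F1 : gen q E1 * gen q F1 = gen q F1 * gen q E1 +
    (q - q⁻¹)⁻¹ • (gen q K1 - gen q Gen.I * gen q K1inv) := by
  have := RingQuot.mkAlgHom_rel ℂ (Rel.E1_F1 (q := q))
  rw [bracket, map_sub, map_smul, map_sub, map_mul, map_mul, map_mul, sub_eq_iff_eq_add'] at this
  exact this

theorem gen_E2_F2 : gen q E2 * gen q F2 = gen q F2 * gen q E2 +
    (q - q⁻¹)⁻¹ • (gen q Gen.I * gen q K2 - gen q K2inv) := by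
  have := RingQuot.mkAlgHom_rel ℂ (Rel.E2_F2 (q := q))
  rw [bracket, map_sub, map_smul, map_sub, map_mul, map_mul, map_mul, sub_eq_iff_eq_add'] at this
  exact this

section Module

variable (V : Type*) [AddCommGroup V] [Module ℂ V] [Module (WAlg q) V] [IsScalarTower ℂ (WAlg q) V]

theorem act_mul (x y : WAlg q) : act V (x * y) = act V x * act V y := map_mul _ x y

theorem act_smul (a : ℂ) (x : WAlg q) : act V (a • x) = a • act V x := map_smul _ a x

theorem act_add (x y : WAlg q) : act V (x + y) = act V x + act V y := map_add _ x y

theorem act_sub (x y : WAlg q) : act V (x - y) = act V x - act V y := map_sub _ x y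

theorem act_one : act V (1 : WAlg q) = 1 := map_one _

theorem commute_act {x y : WAlg q} (h : Commute x y) : Commute (act V x) (act V y) := by
  rw [Commute, SemiconjBy, ← act_mul, h.eq, act_mul]

/-- The action of an invertible generator as a unit. -/
noncomputable def actUnit {x y : Gen} (h1 : gen q x * gen q y = 1) (h2 : gen q y * gen q x = 1) :
    (Module.End ℂ V)ˣ where
  val := act V (gen q x)
  inv := act V (gen q y)
  val_inv := by rw [← act_mul, h1, act_one]
  inv_val := by rw [← act_mul, h2, act_one]

/-- The action of `I`. -/
noncomputable def actI : (Module.End ℂ V)ˣ :=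
  actUnit V (gen_mul_gen_eq_one (q := q) .I_mul_Iinv) (gen_mul_gen_eq_one .Iinv_mul_I)

/-- The action of `K₁`. -/
noncomputable def actK1 : (Module.End ℂ V)ˣ :=
  actUnit V (gen_mul_gen_eq_one (q := q) .K1_mul_K1inv) (gen_mul_gen_eq_one .K1inv_mul_K1)

/-- The action of `K₂`. -/
noncomputable def actK2 : (Module.End ℂ V)ˣ :=
  actUnit V (gen_mul_gen_eq_one (q := q) .K2_mul_K2inv) (gen_mul_gen_eq_one .K2inv_mul_K2)

theorem val_actI : (actI (q := q) V : Module.End ℂ V) = act V (gen q Gen.I) := rfl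

theorem val_actK1 : (actK1 (q := q) V : Module.End ℂ V) = act V (gen q K1) := rfl

theorem val_actK2 : (actK2 (q := q) V : Module.End ℂ V) = act V (gen q K2) := rfl

theorem commute_actI_actK1 : Commute (actI (q := q) V) (actK1 (q := q) V) :=
  Units.ext (commute_act V (commute_gen_I (q := q) K1)).eq

theorem commute_actI_actK2 : Commute (actI (q := q) V) (actK2 (q := q) V) :=
  Units.ext (commute_act V (commute_gen_I (q := q) K2)).eq

variable {V} in
theorem E_mul_K_aux (hq0 : q ≠ 0) {E K : Gen} (h : Rel q (qBracket q (fr E) (fr K)) 0) :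
    act V (gen q E) * act V (gen q K) = (q ^ 2)⁻¹ • (act V (gen q K) * act V (gen q E)) := by
  rw [← act_mul, gen_mul_gen_of_qBracket hq0 h, act_smul, act_mul]

variable {V} in
theorem F_mul_K_aux (hq0 : q ≠ 0) {F K : Gen} (h : Rel q (qBracket q (fr K) (fr F)) 0) :
    act V (gen q F) * act V (gen q K) = (q ^ 2) • (act V (gen q K) * act V (gen q F)) := by
  rw [← act_mul V (gen q K), gen_mul_gen_of_qBracket hq0 h, act_smul, smul_smul,
    mul_inv_cancel₀ (pow_ne_zero 2 hq0), one_smul, act_mul]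

theorem isQTriple_one (hq0 : q ≠ 0) : IsQTriple (q ^ 2) (q - q⁻¹)⁻¹ (act V (gen q E1))
    (act V (gen q F1)) (actK1 (q := q) V) (actI (q := q) V) where
  E_mul_K := E_mul_K_aux hq0 .E1_K1
  F_mul_K := F_mul_K_aux hq0 .K1_F1
  comm_IE := commute_act V (commute_gen_I E1)
  comm_IF := commute_act V (commute_gen_I F1)
  comm_IK := commute_actI_actK1 V
  E_mul_F := by
    rw [← act_mul, gen_E1_F1, act_add, act_mul, act_smul, act_sub, act_mul]
    rfl

/-- Taking `K = I K₂` makes `I K⁻¹ = K₂⁻¹`, so `I K₂ - K₂⁻¹` takes the form `K - I K⁻¹`. -/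
theorem isQTriple_two (hq0 : q ≠ 0) : IsQTriple (q ^ 2) (q - q⁻¹)⁻¹ (act V (gen q E2))
    (act V (gen q F2)) (actI (q := q) V * actK2 (q := q) V) (actI (q := q) V) where
  E_mul_K := by
    change act V (gen q E2) * (act V (gen q Gen.I) * act V (gen q K2)) =
      (q ^ 2)⁻¹ • ((act V (gen q Gen.I) * act V (gen q K2)) * act V (gen q E2))
    rw [← mul_assoc, ← (commute_act V (commute_gen_I (q := q) E2)).eq, mul_assoc, E_mul_K_aux hq0 .E2_K2,
      mul_smul_comm, mul_assoc]
  F_mul_K := by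
    change act V (gen q F2) * (act V (gen q Gen.I) * act V (gen q K2)) =
      (q ^ 2) • ((act V (gen q Gen.I) * act V (gen q K2)) * act V (gen q F2))
    rw [← mul_assoc, ← (commute_act V (commute_gen_I (q := q) F2)).eq, mul_assoc, F_mul_K_aux hq0 .K2_F2,
      mul_smul_comm, mul_assoc]
  comm_IE := commute_act V (commute_gen_I E2)
  comm_IF := commute_act V (commute_gen_I F2)
  comm_IK := (Commute.refl _).mul_right (commute_actI_actK2 V)
  E_mul_F := by
    have : actI (q := q) V * (actI (q := q) V * actK2 (q := q) V)⁻¹ = (actK2 (q := q) V)⁻¹ := by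
      rw [(commute_actI_actK2 V).eq]; group
    rw [this, ← act_mul, gen_E2_F2, act_add, act_mul, act_smul, act_sub, act_mul]
    rfl

/-! ### Complete reducibility makes `I` diagonalizable. -/

theorem smul_mem_of_gen {S : Submodule ℂ V} (h : ∀ g : Gen, ∀ x ∈ S, gen q g • x ∈ S) (X : WAlg q) :
    ∀ x ∈ S, X • x ∈ S := by
  obtain ⟨f, rfl⟩ := RingQuot.mkAlgHom_surjective ℂ (Rel q) X
  induction f using FreeAlgebra.induction with
  | grade0 r =>
    intro x hx
    rw [AlgHom.commutes, algebraMap_smul]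
    exact S.smul_mem r hx
  | grade1 g => exact h g
  | mul a b ha hb => intro x hx; rw [map_mul, mul_smul]; exact ha _ (hb _ hx)
  | add a b ha hb => intro x hx; rw [map_add, add_smul]; exact S.add_mem (ha _ hx) (hb _ hx)

/-- A subspace stable under the generators, as a `𝔚_q`-submodule. -/
def submoduleOfGen (S : Submodule ℂ V) (h : ∀ g : Gen, ∀ x ∈ S, gen q g • x ∈ S) :
    Submodule (WAlg q) V :=
  { S with smul_mem' := fun X x hx => smul_mem_of_gen V h X x hx }

variable [FiniteDimensional ℂ V]

theorem isDiagonalizableOn_I_of_isSemisimpleModule [IsSemisimpleModule (WAlg q) V] :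
    IsDiagonalizableOn V (gen q Gen.I) := by
  set S : Submodule ℂ V := ⨆ θ : ℂ, (act V (gen q Gen.I)).eigenspace θ with hS
  have hstab : ∀ g : Gen, ∀ x ∈ S, gen q g • x ∈ S := by
    intro g x hx
    refine Submodule.iSup_induction _ (motive := fun x => gen q g • x ∈ S) hx ?_ ?_ ?_
    · intro μ x hx
      exact Submodule.mem_iSup_of_mem μ
        (Module.End.apply_mem_eigenspace_of_commute (commute_act V (commute_gen_I g)) μ x hx)
    · rw [smul_zero]; exact S.zero_mem
    · intro x y hx hy; rw [smul_add]; exact S.add_mem hx hy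
  obtain ⟨C, hC⟩ := exists_isCompl (submoduleOfGen V S hstab)
  -- A nonzero complement is stable under `I`, hence contains an eigenvector of `I`, which also lies
  -- in `S`.
  have hCbot : C = ⊥ := by
    by_contra hne
    have hnt : Nontrivial (C.restrictScalars ℂ) :=
      show Nontrivial C from Submodule.nontrivial_iff_ne_bot.2 hne
    obtain ⟨μ, hμ⟩ := Module.End.exists_eigenvalue
      ((act V (gen q Gen.I)).restrict (p := C.restrictScalars ℂ) (q := C.restrictScalars ℂ)
        fun x hx => C.smul_mem _ hx)
    obtain ⟨x, hx⟩ := hμ.exists_hasEigenvector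
    have hx1 := congrArg Subtype.val hx.apply_eq_smul
    have hxS : (x : V) ∈ S := Submodule.mem_iSup_of_mem μ (Module.End.mem_eigenspace_iff.2 hx1)
    have := hC.disjoint.le_bot (show (x : V) ∈ submoduleOfGen V S hstab ⊓ C from ⟨hxS, x.2⟩)
    exact hx.2 (Subtype.ext ((Submodule.mem_bot (WAlg q)).1 this))
  rw [hCbot] at hC
  have htop := hC.sup_eq_top
  rw [sup_bot_eq] at htop
  rw [IsDiagonalizableOn, ← hS, eq_top_iff]
  intro x _
  exact (htop ▸ Submodule.mem_top : x ∈ submoduleOfGen V S hstab)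

end Module

theorem sq_pow_ne_one (hq : ∀ n : ℕ, 0 < n → q ^ n ≠ 1) : ∀ n : ℕ, 0 < n → (q ^ 2) ^ n ≠ 1 := by
  intro n hn
  rw [← pow_mul]
  exact hq _ (by positivity)

theorem inv_sub_inv_ne_zero (hq0 : q ≠ 0) (hq : ∀ n : ℕ, 0 < n → q ^ n ≠ 1) : (q - q⁻¹)⁻¹ ≠ 0 := by
  refine inv_ne_zero (sub_ne_zero.2 fun h => hq 2 two_pos ?_)
  rw [pow_two]
  nth_rewrite 1 [h]
  exact inv_mul_cancel₀ hq0

/-! ### Simple highest weight modules and complete reducibility. -/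

section Module

variable (V : Type*) [AddCommGroup V] [Module ℂ V] [Module (WAlg q) V] [IsScalarTower ℂ (WAlg q) V]

variable {V} in
theorem gen_smul_mem_powSpan (hq0 : q ≠ 0) {v : V} (hE1 : act V (gen q E1) v = 0)
    (hE2 : act V (gen q E2) v = 0) {k₁ k₂ ι : ℂ} (hK1 : act V (gen q K1) v = k₁ • v)
    (hK2 : act V (gen q K2) v = k₂ • v) (hI : act V (gen q Gen.I) v = ι • v) (g : Gen) :
    ∀ x ∈ (Submodule.powSpan (act V (gen q F2)) (ℂ ∙ v)).powSpan (act V (gen q F1)),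
      gen q g • x ∈ (Submodule.powSpan (act V (gen q F2)) (ℂ ∙ v)).powSpan (act V (gen q F1)) := by
  have hp0 : q ^ 2 ≠ 0 := pow_ne_zero 2 hq0
  have span_stable : ∀ {A : Module.End ℂ V} {μ : ℂ}, A v = μ • v → ∀ x ∈ ℂ ∙ v, A x ∈ ℂ ∙ v := by
    intro A μ hA x hx
    obtain ⟨a, rfl⟩ := Submodule.mem_span_singleton.1 hx
    rw [map_smul, hA]
    exact Submodule.smul_mem _ _ (Submodule.smul_mem _ _ (Submodule.mem_span_singleton_self v))
  have inv : ∀ {A : (Module.End ℂ V)ˣ} {μ : ℂ}, (A : Module.End ℂ V) v = μ • v →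
      (↑A⁻¹ : Module.End ℂ V) v = μ⁻¹ • v := fun {A μ} hA => Module.End.mem_eigenspace_iff.1
    (Module.End.eigenspace_units_le_inv A μ (Module.End.mem_eigenspace_iff.2 hA))
  have hK1i : act V (gen q K1inv) v = k₁⁻¹ • v := inv (A := actK1 V) hK1
  have hK2i : act V (gen q K2inv) v = k₂⁻¹ • v := inv (A := actK2 V) hK2
  have hIi : act V (gen q Iinv) v = ι⁻¹ • v := inv (A := actI V) hI
  have inv_right : ∀ {x : Module.End ℂ V} {A : (Module.End ℂ V)ˣ}, Commute x A →
      Commute x (↑A⁻¹ : Module.End ℂ V) := fun h => h.units_inv_right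
  have c1I := (commute_act V (commute_gen_I (q := q) F1)).symm
  have c2I := (commute_act V (commute_gen_I (q := q) F2)).symm
  have c1Ii : Commute (act V (gen q F1)) (act V (gen q Iinv)) := inv_right (A := actI V) c1I
  have c2Ii : Commute (act V (gen q F2)) (act V (gen q Iinv)) := inv_right (A := actI V) c2I
  have c1K2 := (commute_act V (gen_mul_gen_of_bracket (q := q) .K2_F1)).symm
  have c2K1 := (commute_act V (gen_mul_gen_of_bracket (q := q) .K1_F2)).symm
  have c1K2i : Commute (act V (gen q F1)) (act V (gen q K2inv)) := inv_right (A := actK2 V) c1K2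
  have c2K1i : Commute (act V (gen q F2)) (act V (gen q K1inv)) := inv_right (A := actK1 V) c2K1
  have c12 := commute_act V (gen_mul_gen_of_bracket (q := q) .F1_F2)
  have c1E := commute_act V (gen_mul_gen_of_bracket (q := q) .F1_E2)
  have c2E := (commute_act V (gen_mul_gen_of_bracket (q := q) .E1_F2)).symm
  have f1K := F_mul_K_aux (V := V) hq0 .K1_F1
  have f2K := F_mul_K_aux (V := V) hq0 .K2_F2
  have f1Ki : act V (gen q F1) * act V (gen q K1inv) =
    (q ^ 2)⁻¹ • (act V (gen q K1inv) * act V (gen q F1)) :=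
    mul_unit_inv_of_mul_unit (K := actK1 V) hp0 f1K
  have f2Ki : act V (gen q F2) * act V (gen q K2inv) =
    (q ^ 2)⁻¹ • (act V (gen q K2inv) * act V (gen q F2)) :=
    mul_unit_inv_of_mul_unit (K := actK2 V) hp0 f2K
  set T := Submodule.powSpan (act V (gen q F2)) (ℂ ∙ v) with hT
  have tI := Submodule.apply_mem_powSpan_of_commute c2I (span_stable hI)
  have tIi := Submodule.apply_mem_powSpan_of_commute c2Ii (span_stable hIi)
  have tK1 := Submodule.apply_mem_powSpan_of_commute c2K1 (span_stable hK1)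
  have tK1i := Submodule.apply_mem_powSpan_of_commute c2K1i (span_stable hK1i)
  have tK2 := Submodule.apply_mem_powSpan hp0 f2K (span_stable hK2)
  have tK2i := Submodule.apply_mem_powSpan (inv_ne_zero hp0) f2Ki (span_stable hK2i)
  have tE2 : ∀ x ∈ T, act V (gen q E2) x ∈ T := by
    refine (isQTriple_two V hq0).E_apply_mem_powSpan ?_ (fun x hx => tI _ (tK2 x hx)) fun x hx => ?_
    · intro x hx
      obtain ⟨a, rfl⟩ := Submodule.mem_span_singleton.1 hx
      rw [map_smul, hE2, smul_zero]
    · rw [mul_inv_rev, Units.val_mul, Units.val_mul, Module.End.mul_apply, Module.End.mul_apply]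
      exact tI _ (tK2i _ (tIi _ hx))
  -- `E₁` commutes with `F₂`, so `T` consists of highest weight vectors for the first triple.
  have tE1 : ∀ x ∈ T, act V (gen q E1) x = 0 := fun x hx =>
    (Submodule.mem_bot ℂ).1 <| Submodule.apply_mem_powSpan_of_forall (W := ⊥) (fun a t ht => by
      obtain ⟨b, rfl⟩ := Submodule.mem_span_singleton.1 ht
      rw [← Module.End.mul_apply, (c2E.symm.pow_right a).eq, Module.End.mul_apply, map_smul, hE1,
        smul_zero, map_zero]
      exact Submodule.zero_mem _) x hx
  have sI := Submodule.apply_mem_powSpan_of_commute c1I tI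
  have sIi := Submodule.apply_mem_powSpan_of_commute c1Ii tIi
  have sK2 := Submodule.apply_mem_powSpan_of_commute c1K2 tK2
  have sK2i := Submodule.apply_mem_powSpan_of_commute c1K2i tK2i
  have sK1 := Submodule.apply_mem_powSpan hp0 f1K tK1
  have sK1i := Submodule.apply_mem_powSpan (inv_ne_zero hp0) f1Ki tK1i
  cases g with
  | E1 =>
    refine (isQTriple_one V hq0).E_apply_mem_powSpan tE1 sK1 fun x hx => ?_
    rw [Units.val_mul, Module.End.mul_apply]
    exact sI _ (sK1i _ hx)
  | E2 => exact Submodule.apply_mem_powSpan_of_commute c1E tE2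
  | F1 => exact Submodule.self_apply_mem_powSpan
  | F2 => exact Submodule.apply_mem_powSpan_of_commute c12 Submodule.self_apply_mem_powSpan
  | K1 => exact sK1
  | K1inv => exact sK1i
  | K2 => exact sK2
  | K2inv => exact sK2i
  | I => exact sI
  | Iinv => exact sIi

variable {V} in
theorem isSimpleModule_span_singleton [FiniteDimensional ℂ V] (hq0 : q ≠ 0)
    (hq : ∀ n : ℕ, 0 < n → q ^ n ≠ 1) {v : V} (hv : v ≠ 0) (hE1 : act V (gen q E1) v = 0)
    (hE2 : act V (gen q E2) v = 0) {k₁ k₂ ι : ℂ} (hK1 : act V (gen q K1) v = k₁ • v)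
    (hK2 : act V (gen q K2) v = k₂ • v) (hI : act V (gen q Gen.I) v = ι • v) :
    IsSimpleModule (WAlg q) (Submodule.span (WAlg q) {v}) := by
  have hp0 : q ^ 2 ≠ 0 := pow_ne_zero 2 hq0
  have hp := sq_pow_ne_one hq
  have hc := inv_sub_inv_ne_zero hq0 hq
  rw [isSimpleModule_iff_isAtom]
  refine ⟨fun h => hv (Submodule.span_singleton_eq_bot.1 h), fun Q hQ => ?_⟩
  by_contra hQ0
  obtain ⟨x, hxQ, hx0⟩ := Submodule.exists_mem_ne_zero_of_ne_bot hQ0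
  refine hQ.not_ge ((Submodule.span_singleton_le_iff_mem _ _).2 ?_)
  have hxS : x ∈ (Submodule.powSpan (act V (gen q F2)) (ℂ ∙ v)).powSpan (act V (gen q F1)) := by
    have hle : Submodule.span (WAlg q) {v} ≤ submoduleOfGen V _
        (gen_smul_mem_powSpan hq0 hE1 hE2 hK1 hK2 hI) :=
      (Submodule.span_singleton_le_iff_mem _ _).2
        (Submodule.le_powSpan (Submodule.le_powSpan (Submodule.mem_span_singleton_self v)))
    exact hle (hQ.le hxQ)
  have powSpan_eigen : ∀ {A : Module.End ℂ V} {μ : ℂ}, Commute A (act V (gen q F2)) → A v = μ • v →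
      ∀ t ∈ Submodule.powSpan (act V (gen q F2)) (ℂ ∙ v), A t = μ • t := by
    intro A μ hA hμ t ht
    rw [← Module.End.mem_eigenspace_iff]
    refine Submodule.powSpan_le (W := A.eigenspace μ) (fun a t ht => ?_) ht
    obtain ⟨b, rfl⟩ := Submodule.mem_span_singleton.1 ht
    rw [Module.End.mem_eigenspace_iff, ← Module.End.mul_apply, (hA.pow_right a).eq, Module.End.mul_apply,
      map_smul, hμ, smul_comm, map_smul]
  have span_eigen : ∀ {A : Module.End ℂ V} {μ : ℂ}, A v = μ • v → ∀ t ∈ ℂ ∙ v, A t = μ • t := by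
    intro A μ hA t ht
    obtain ⟨b, rfl⟩ := Submodule.mem_span_singleton.1 ht
    rw [map_smul, hA, smul_comm]
  have pow_mem : ∀ (g : Gen) (m : ℕ) (y : V), y ∈ Q → (act V (gen q g) ^ m) y ∈ Q := fun g m y hy =>
    Module.End.pow_apply_mem (W := Q.restrictScalars ℂ) (fun z hz => Q.smul_mem (gen q g) hz) m hy
  -- Powers of `E₁` raise `x` into the span of the `F₂ ^ b v`, then powers of `E₂` raise it to a
  -- nonzero multiple of `v`, all inside `Q`.
  obtain ⟨m, hmT, hm0⟩ := (isQTriple_one V hq0).exists_E_pow_apply_mem hp0 hp hc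
    (fun t ht => by
      rw [powSpan_eigen (μ := 0) (commute_act V (gen_mul_gen_of_bracket (q := q) .E1_F2))
        (by rw [hE1, zero_smul]) t ht, zero_smul])
    (powSpan_eigen (commute_act V (gen_mul_gen_of_bracket (q := q) .K1_F2)) hK1)
    (powSpan_eigen (commute_act V (commute_gen_I (q := q) F2)) hI) hxS hx0
  obtain ⟨n, hnT, hn0⟩ := (isQTriple_two V hq0).exists_E_pow_apply_mem hp0 hp hc
    (fun t ht => by
      rw [span_eigen (μ := 0) (by rw [hE2, zero_smul]) t ht, zero_smul])
    (κ := ι * k₂) (span_eigen (by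
      rw [Units.val_mul, Module.End.mul_apply]
      change act V (gen q Gen.I) (act V (gen q K2) v) = _
      rw [hK2, map_smul, hI, smul_smul, mul_comm]))
    (span_eigen hI) hmT hm0
  have hmem := pow_mem E2 n _ (pow_mem E1 m _ hxQ)
  obtain ⟨a, ha⟩ := Submodule.mem_span_singleton.1 hnT
  rw [← ha] at hmem hn0
  have ha0 : a ≠ 0 := fun h => hn0 (by rw [h, zero_smul])
  have := (Q.restrictScalars ℂ).smul_mem a⁻¹ hmem
  rwa [smul_smul, inv_mul_cancel₀ ha0, one_smul] at this

theorem isSemisimpleModule_of_isDiagonalizableOn [FiniteDimensional ℂ V] (hq0 : q ≠ 0)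
    (hq : ∀ n : ℕ, 0 < n → q ^ n ≠ 1) (h1 : IsDiagonalizableOn V (gen q K1))
    (h2 : IsDiagonalizableOn V (gen q K2)) (h3 : IsDiagonalizableOn V (gen q Gen.I)) :
    IsSemisimpleModule (WAlg q) V := by
  have hp0 : q ^ 2 ≠ 0 := pow_ne_zero 2 hq0
  have hp := sq_pow_ne_one hq
  have hc := inv_sub_inv_ne_zero hq0 hq
  refine IsSemisimpleModule.of_sSup_simples_eq_top ?_
  set W : Submodule (WAlg q) V := sSup {m : Submodule (WAlg q) V | IsSimpleModule (WAlg q) m} with hW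
  have hWF : ∀ g : Gen, ∀ x ∈ W.restrictScalars ℂ, act V (gen q g) x ∈ W.restrictScalars ℂ :=
    fun g x hx => W.smul_mem (gen q g) hx
  suffices h : W.restrictScalars ℂ = ⊤ from (Submodule.restrictScalars_eq_top_iff ℂ (WAlg q) V).1 h
  have ker_inv : ∀ {A B : Module.End ℂ V} {a : ℂ}, A * B = a • (B * A) →
      ∀ x ∈ LinearMap.ker A, B x ∈ LinearMap.ker A := mem_ker_of_mul_eq_smul
  have hcomm : ∀ {A B : Module.End ℂ V}, Commute A B → A * B = (1 : ℂ) • (B * A) :=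
    fun h => by rw [h.eq, one_smul]
  have e1I := (commute_act V (commute_gen_I (q := q) E1)).symm
  have e2I := (commute_act V (commute_gen_I (q := q) E2)).symm
  have e1K2 := (commute_act V (gen_mul_gen_of_bracket (q := q) .K2_E1)).symm
  have e2K1 := (commute_act V (gen_mul_gen_of_bracket (q := q) .K1_E2)).symm
  -- The first triple reduces the claim to `ker E₁`; the second, with `G = E₁`, reduces it to `ker
  -- E₁ ⊓ ker E₂`.
  refine (isQTriple_one V hq0).eq_top_of_ker_le hp0 hp hc (hWF F1) ?_
  refine (isQTriple_two V hq0).ker_le_of_ker_inf_ker_le hp0 hp hc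
    (commute_act V (gen_mul_gen_of_bracket .E1_E2)) (commute_act V (gen_mul_gen_of_bracket .E1_F2))
    ?_ e1I (hWF F2) ?_
  · rw [Units.val_mul]; exact e1I.mul_right e1K2
  have inf_stable : ∀ {P Q : Submodule ℂ V} {A : Module.End ℂ V}, (∀ x ∈ P, A x ∈ P) →
      (∀ x ∈ Q, A x ∈ Q) → ∀ x ∈ P ⊓ Q, A x ∈ P ⊓ Q := fun hP hQ x hx => ⟨hP x hx.1, hQ x hx.2⟩
  have cIK1 := commute_act V (commute_gen_I (q := q) K1)
  have cIK2 := commute_act V (commute_gen_I (q := q) K2)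
  have cK1K2 := commute_act V (gen_mul_gen_of_bracket (q := q) .K1_K2)
  -- `I`, `K₁` and `K₂` preserve this intersection, so it can be cut into common eigenspaces one
  -- operator at a time.
  refine Module.End.le_of_forall_inf_eigenspace_le h3
    (inf_stable (ker_inv (hcomm e1I)) (ker_inv (hcomm e2I))) fun ι => ?_
  refine Module.End.le_of_forall_inf_eigenspace_le h1
    (inf_stable (inf_stable (ker_inv (E_mul_K_aux hq0 .E1_K1)) (ker_inv (hcomm e2K1)))
      (Module.End.apply_mem_eigenspace_of_commute cIK1 ι)) fun k₁ => ?_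
  refine Module.End.le_of_forall_inf_eigenspace_le h2
    (inf_stable (inf_stable (inf_stable (ker_inv (hcomm e1K2)) (ker_inv (E_mul_K_aux hq0 .E2_K2)))
      (Module.End.apply_mem_eigenspace_of_commute cIK2 ι))
      (Module.End.apply_mem_eigenspace_of_commute cK1K2 k₁)) fun k₂ => ?_
  rintro v ⟨⟨⟨⟨hE1, hE2⟩, hI⟩, hK1⟩, hK2⟩
  by_cases hv : v = 0
  · rw [hv]; exact Submodule.zero_mem _
  have hs := isSimpleModule_span_singleton hq0 hq hv hE1 hE2 (Module.End.mem_eigenspace_iff.1 hK1)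
    (Module.End.mem_eigenspace_iff.1 hK2) (Module.End.mem_eigenspace_iff.1 hI)
  have hle : Submodule.span (WAlg q) {v} ≤ W := le_sSup hs
  exact hle (Submodule.mem_span_singleton_self v)

/-! ### Comparing `K₁` and `K₂` with `I`. -/

theorem isDiagonalizableOn_K1_iff [FiniteDimensional ℂ V] (hq0 : q ≠ 0)
    (hq : ∀ n : ℕ, 0 < n → q ^ n ≠ 1) :
    IsDiagonalizableOn V (gen q K1) ↔ IsDiagonalizableOn V (gen q Gen.I) := by
  rw [IsDiagonalizableOn, IsDiagonalizableOn, ← val_actK1, ← val_actI]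
  exact Module.End.iSup_eigenspace_iff_of_sq_mul_inv (commute_actI_actK1 V).symm
    ((isQTriple_one V hq0).iSup_eigenspace_X (pow_ne_zero 2 hq0) (sq_pow_ne_one hq)
      (inv_sub_inv_ne_zero hq0 hq))

theorem isDiagonalizableOn_K2_iff [FiniteDimensional ℂ V] (hq0 : q ≠ 0)
    (hq : ∀ n : ℕ, 0 < n → q ^ n ≠ 1) :
    IsDiagonalizableOn V (gen q K2) ↔ IsDiagonalizableOn V (gen q Gen.I) := by
  have hX := (isQTriple_two V hq0).iSup_eigenspace_X (pow_ne_zero 2 hq0) (sq_pow_ne_one hq)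
    (inv_sub_inv_ne_zero hq0 hq)
  have hc := commute_actI_actK2 (q := q) V
  -- For the second triple `X = K₂² I`, so the square criterion applies with `J = I⁻¹` and first
  -- compares `K₂` with `I⁻¹`.
  have e : actI (q := q) V * actK2 (q := q) V * (actI (q := q) V * actK2 (q := q) V) *
      (actI (q := q) V)⁻¹ =
      actK2 (q := q) V * actK2 (q := q) V * (actI (q := q) V)⁻¹⁻¹ := by
    generalize actI (q := q) V = a at hc
    generalize actK2 (q := q) V = b at hc
    calc a * b * (a * b) * a⁻¹ = b * a * (b * a) * a⁻¹ := by rw [hc.eq]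
      _ = b * (a * b) := by group
      _ = b * b * a⁻¹⁻¹ := by rw [hc.eq, inv_inv, mul_assoc]
  rw [e] at hX
  rw [IsDiagonalizableOn, IsDiagonalizableOn, ← val_actK2, ← val_actI]
  refine (Module.End.iSup_eigenspace_iff_of_sq_mul_inv hc.symm.inv_right hX).trans
    ⟨fun h => ?_, Module.End.iSup_eigenspace_units_inv (actI V)⟩
  have := Module.End.iSup_eigenspace_units_inv _ h
  rwa [inv_inv] at this

end Module

end WAlg

theorem mainTheorem9 (q : ℂ) (hq0 : q ≠ 0) (hq : ∀ n : ℕ, 0 < n → q ^ n ≠ 1)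
    (V : Type*) [AddCommGroup V] [Module ℂ V] [Module (WAlg q) V] [IsScalarTower ℂ (WAlg q) V]
    [FiniteDimensional ℂ V] :
    List.TFAE
      [IsSemisimpleModule (WAlg q) V,
       WAlg.IsDiagonalizableOn V (WAlg.gen q WAlg.Gen.K1),
       WAlg.IsDiagonalizableOn V (WAlg.gen q WAlg.Gen.K2),
       WAlg.IsDiagonalizableOn V (WAlg.gen q WAlg.Gen.I)] := by
  have h1 := WAlg.isDiagonalizableOn_K1_iff V hq0 hq
  have h2 := WAlg.isDiagonalizableOn_K2_iff V hq0 hq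
  tfae_have 1 → 4 := fun _ => WAlg.isDiagonalizableOn_I_of_isSemisimpleModule V
  tfae_have 2 ↔ 4 := h1
  tfae_have 3 ↔ 4 := h2
  tfae_have 4 → 1 := fun h =>
    WAlg.isSemisimpleModule_of_isDiagonalizableOn V hq0 hq (h1.2 h) (h2.2 h) h
  tfae_finish
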